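/- For a group $H$ with a finite generating set $S$, let $|h|_S$ be the word length of $h$ (the least length of a word over $S\cup S^{-1}$ representing $h$), let $d_S(h,h')=|h^{-1}h'|_S$ be the word metric, and for a conjugacy class $c$ of $H$ let $\|c\|_S=\min_{h\in c}|h|_S$. The Lipschitz metric on $\mathrm{Out}(H)$ (an asymmetric pseudo-metric) is defined by $$d_{\mathrm{Lip}}(\Phi_1,\Phi_2)=\ln\left(\sup_{c}\frac{\|\Phi_2^{-1}(c)\|_S}{\|\Phi_1^{-1}(c)\|_S}\right),\qquad \Phi_1,\Phi_2\in\mathrm{Out}(H),$$ where $c$ runs over all non-trivial conjugacy classes of $H$. **Proposition.** Let $1\to N\to G\to Q\to 1$ be a short exact sequence of groups, where $N$ and $Q$ are finitely generated, $G$ is hyperbolic in the sense of Gromov and non-elementary (that is, not virtually cyclic), and $N$ is infinite. Let $\chi:Q\to\mathrm{Out}(N)$ be the homomorphism induced by the action of $G$ on $N$ by conjugation. Fix arbitrary finite generating sets of $N$ and $Q$, let $d$ be the resulting word metric on $Q$, and let $d_{\mathrm{Lip}}$ be the resulting Lipschitz metric on $\mathrm{Out}(N)$. Then $\chi$ is a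 quasi-isometric embedding. More precisely, there exist $\kappa\ge 1$ and $\ell\ge 0$ such that for all $q,q'\in Q$, $$\kappa^{-1}d(q',q)-\ell\;\le\; d_{\mathrm{Lip}}(\chi(q'),\chi(q))\;\le\;\kappa\, d(q',q).$$ -/

import Mathlib

noncomputable section

/-- The word length of `g` with respect to `S`: the least length of a word over `S ∪ S⁻¹`
representing `g`. (Meaningful when `S` generates the group.) -/
def wordLength {G : Type*} [Group G] (S : Set G) (g : G) : ℕ :=
  sInf {n | ∃ l : List G, (∀ x ∈ l, x ∈ S ∨ x⁻¹ ∈ S) ∧ l.prod = g ∧ l.length = n}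

/-- The left-invariant word metric with respect to `S`. -/
def wordDist {G : Type*} [Group G] (S : Set G) (g h : G) : ℕ :=
  wordLength S (g⁻¹ * h)

/-- The norm of a conjugacy class: the length of its shortest elements. -/
def conjNorm {G : Type*} [Group G] (S : Set G) (c : ConjClasses G) : ℕ :=
  sInf (wordLength S '' {g | ConjClasses.mk g = c})

/-- The Gromov product `(x | y)_w` in the word metric with respect to `S`. -/
def gromovProduct {G : Type*} [Group G] (S : Set G) (w x y : G) : ℝ :=
  ((wordDist S w x : ℝ) + wordDist S w y - wordDist S x y) / 2

/-- A group is hyperbolic in the sense of Gromov if it has a finite generating set for whose word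
metric there is `δ` with `(x | z)_w ≥ min ((x | y)_w) ((y | z)_w) - δ` for all `w, x, y, z`. -/
def IsHyperbolicGroup (G : Type*) [Group G] : Prop :=
  ∃ S : Set G, S.Finite ∧ Subgroup.closure S = ⊤ ∧ ∃ δ : ℝ, ∀ w x y z : G,
    min (gromovProduct S w x y) (gromovProduct S w y z) - δ ≤ gromovProduct S w x z

/-- A group is elementary if it is virtually cyclic (this includes finite groups). -/
def IsElementaryGroup (G : Type*) [Group G] : Prop :=
  ∃ H : Subgroup G, H.FiniteIndex ∧ IsCyclic H

/-- The group of inner automorphisms. -/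
abbrev InnerAut (N : Type*) [Group N] : Subgroup (MulAut N) :=
  (MulAut.conj : N →* MulAut N).range

instance InnerAut.normal (N : Type*) [Group N] : (InnerAut N).Normal := by
  constructor
  rintro _ ⟨n, rfl⟩ φ
  refine ⟨φ n, ?_⟩
  ext x
  simp [MulAut.conj_apply]

/-- The group `Out(N)` of outer automorphisms. -/
abbrev OuterAut (N : Type*) [Group N] : Type _ := MulAut N ⧸ InnerAut N

/-- The action of `Aut(N)` on the set of conjugacy classes of `N`. -/
def autConjClasses (N : Type*) [Group N] : MulAut N →* Equiv.Perm (ConjClasses N) :=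
  MonoidHom.toHomPerm
    { toFun := fun φ => ConjClasses.map φ.toMonoidHom
      map_one' := by
        funext c
        obtain ⟨x, rfl⟩ := ConjClasses.exists_rep c
        rfl
      map_mul' := by
        intro φ ψ
        funext c
        obtain ⟨x, rfl⟩ := ConjClasses.exists_rep c
        rfl }

theorem autConjClasses_mk {N : Type*} [Group N] (φ : MulAut N) (x : N) :
    autConjClasses N φ (ConjClasses.mk x) = ConjClasses.mk (φ x) := rfl

/-- The action of `Out(N)` on the set of conjugacy classes of `N`, induced by the action of
`Aut(N)`. -/
def outerConjClasses (N : Type*) [Group N] : OuterAut N →* Equiv.Perm (ConjClasses N) :=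
  QuotientGroup.lift (InnerAut N) (autConjClasses N) (by
    rintro _ ⟨n, rfl⟩
    ext c
    obtain ⟨x, rfl⟩ := ConjClasses.exists_rep c
    rw [autConjClasses_mk, Equiv.Perm.one_apply, ConjClasses.mk_eq_mk_iff_isConj]
    exact (isConj_iff.2 ⟨n, rfl⟩ : IsConj x (MulAut.conj n x)).symm)

theorem outerConjClasses_mk {N : Type*} [Group N] (φ : MulAut N) (x : N) :
    outerConjClasses N (QuotientGroup.mk φ) (ConjClasses.mk x) = ConjClasses.mk (φ x) := rfl

/-- The Lipschitz metric on `Out(N)` associated with the word metric on `N` with respect to `T`: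
`ln (sup_c ‖Φ₂⁻¹ c‖ / ‖Φ₁⁻¹ c‖)`, where `c` runs over the non-trivial conjugacy classes of `N`.
The supremum is taken in `[0, ∞]` and its logarithm in `[-∞, ∞]`. -/
def lipDist {N : Type*} [Group N] (T : Set N) (Φ₁ Φ₂ : OuterAut N) : EReal :=
  ENNReal.log (⨆ c : {c : ConjClasses N // c ≠ 1},
    (conjNorm T (outerConjClasses N Φ₂⁻¹ c.1) : ENNReal) /
      (conjNorm T (outerConjClasses N Φ₁⁻¹ c.1) : ENNReal))

/-- The homomorphism `χ : Q → Out(N)` induced by the action of `G` on `N` by conjugation, for a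
short exact sequence `1 → N → G → Q → 1`. -/
def outerAction {N G Q : Type*} [Group N] [Group G] [Group Q] (E : GroupExtension N G Q) :
    Q →* OuterAut N :=
  E.rightHom.liftOfSurjective E.rightHom_surjective
    ⟨(QuotientGroup.mk' (InnerAut N)).comp E.conjAct, by
      intro g hg
      rw [← E.range_inl_eq_ker_rightHom] at hg
      obtain ⟨n, rfl⟩ := hg
      rw [MonoidHom.mem_ker, MonoidHom.comp_apply, QuotientGroup.mk'_apply,
        QuotientGroup.eq_one_iff]
      refine ⟨n, ?_⟩
      ext x
      apply E.inl_injective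
      rw [E.inl_conjAct_comm, MulAut.conj_apply, map_mul, map_mul, map_inv]⟩

theorem outerAction_rightHom {N G Q : Type*} [Group N] [Group G] [Group Q]
    (E : GroupExtension N G Q) (g : G) :
    outerAction E (E.rightHom g) = QuotientGroup.mk (E.conjAct g) :=
  MonoidHom.liftOfRightInverse_comp_apply _ _ _ _ g

end

/-! ### Word length -/

section WordLength

variable {G : Type*} [Group G] {S : Set G}

/-! Upper bound: a generator of `Q` acts on `N` through an automorphism, which stretches conjugacy
norms by a bounded factor, so an element of length `r` stretches them by at most `Λ ^ r`
(`exists_conjNorm_le_pow`).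

Lower bound: one class, that of some `v` in `N`, grows exponentially under the action
(`exists_le_log_conjNorm`). Since `N` is infinite and normal, it contains an element `n` whose
powers escape along an axis (`exists_isStraight`); take `v = n ^ k`. If `w` in `N` represents the
class of `v` moved by `g`, then `y * w = n ^ k * y` for some `y` lying over the inverse of the image
of `g` in `Q`. Replacing `y` by a translate under `⟨n⟩`, the Gromov product of `y` and `n ^ k * y`
at `1` is bounded (`IsStraight.exists_pow`): a geodesic joining them passes near `1`. A word for `w`
joins the same points inside the coset `yN`, whose distance from `1` is at least linear in the
length of the image of `g`. In a hyperbolic space a path avoiding a large ball in this way is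
exponentially long (`sub_log_mul_le_gromovProductOne`), which bounds `log |w|` below. -/

theorem wordLength_prod_le {l : List G} (hl : ∀ x ∈ l, x ∈ S ∨ x⁻¹ ∈ S) :
    wordLength S l.prod ≤ l.length :=
  Nat.sInf_le ⟨l, hl, rfl, rfl⟩

theorem exists_word (hS : Subgroup.closure S = ⊤) (g : G) :
    ∃ l : List G, (∀ x ∈ l, x ∈ S ∨ x⁻¹ ∈ S) ∧ l.prod = g ∧ l.length = wordLength S g := by
  have hne : {n | ∃ l : List G, (∀ x ∈ l, x ∈ S ∨ x⁻¹ ∈ S) ∧ l.prod = g ∧ l.length = n}.Nonempty := by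
    obtain ⟨l, hl, hg⟩ := Submonoid.exists_list_of_mem_closure (s := S ∪ S⁻¹) (x := g)
      (by rw [← Subgroup.closure_toSubmonoid, hS]; trivial)
    exact ⟨l.length, l, hl, hg, rfl⟩
  exact Nat.sInf_mem hne

theorem wordLength_one : wordLength S (1 : G) = 0 := by
  simpa using wordLength_prod_le (S := S) (l := []) (by simp)

theorem wordLength_of_mem {s : G} (hs : s ∈ S ∨ s⁻¹ ∈ S) : wordLength S s ≤ 1 := by
  simpa using wordLength_prod_le (S := S) (l := [s]) (by simpa using hs)

theorem wordLength_mul_le (hS : Subgroup.closure S = ⊤) (g h : G) :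
    wordLength S (g * h) ≤ wordLength S g + wordLength S h := by
  obtain ⟨l, hl, rfl, hl'⟩ := exists_word hS g
  obtain ⟨m, hm, rfl, hm'⟩ := exists_word hS h
  rw [← hl', ← hm', ← List.prod_append, ← List.length_append]
  refine wordLength_prod_le fun x hx => ?_
  rcases List.mem_append.1 hx with hx | hx
  exacts [hl x hx, hm x hx]

theorem wordLength_inv_le (hS : Subgroup.closure S = ⊤) (g : G) :
    wordLength S g⁻¹ ≤ wordLength S g := by
  obtain ⟨l, hl, rfl, hl'⟩ := exists_word hS g
  rw [← hl', List.prod_inv_reverse]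
  refine (wordLength_prod_le fun x hx => ?_).trans (by simp)
  simp only [List.mem_reverse, List.mem_map] at hx
  obtain ⟨y, hy, rfl⟩ := hx
  rw [inv_inv]
  exact (hl y hy).symm

theorem wordLength_inv (hS : Subgroup.closure S = ⊤) (g : G) :
    wordLength S g⁻¹ = wordLength S g :=
  le_antisymm (wordLength_inv_le hS g) (by simpa using wordLength_inv_le hS g⁻¹)

theorem eq_one_of_wordLength_eq_zero (hS : Subgroup.closure S = ⊤) {g : G}
    (h : wordLength S g = 0) : g = 1 := by
  obtain ⟨l, -, rfl, hl⟩ := exists_word hS g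
  rw [h, List.length_eq_zero_iff] at hl
  simp [hl]

/-- Cut a shortest word after `t` letters: subadditivity forces both pieces to be shortest. This
supplies points on geodesics. -/
theorem exists_mul_wordLength (hS : Subgroup.closure S = ⊤) (g : G) {t : ℕ}
    (ht : t ≤ wordLength S g) :
    ∃ m, wordLength S m = t ∧ wordLength S (m⁻¹ * g) + t = wordLength S g := by
  obtain ⟨l, hl, hg, hl'⟩ := exists_word hS g
  have h1 := wordLength_prod_le (S := S) (l := l.take t) fun x hx => hl x (List.mem_of_mem_take hx)
  have h2 := wordLength_prod_le (S := S) (l := l.drop t) fun x hx => hl x (List.mem_of_mem_drop hx)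
  have h3 := wordLength_mul_le hS (l.take t).prod (l.drop t).prod
  have h4 : (l.take t).prod * (l.drop t).prod = g := by rw [List.prod_take_mul_prod_drop, hg]
  have h5 : (l.take t).prod⁻¹ * g = (l.drop t).prod := by rw [← h4]; group
  rw [h4] at h3
  rw [List.length_take] at h1
  rw [List.length_drop] at h2
  exact ⟨(l.take t).prod, by omega, by rw [h5]; omega⟩

theorem wordLength_map_le {H : Type*} [Group H] {T : Set H} (hS : Subgroup.closure S = ⊤)
    (hT : Subgroup.closure T = ⊤) (f : G →* H) {M : ℕ} (hM : ∀ s ∈ S, wordLength T (f s) ≤ M)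
    (g : G) : wordLength T (f g) ≤ M * wordLength S g := by
  obtain ⟨l, hl, rfl, hl'⟩ := exists_word hS g
  rw [← hl']
  clear hl'
  induction l with
  | nil => simp [wordLength_one]
  | cons s l ih =>
    have h1 : wordLength T (f s) ≤ M := by
      rcases hl s (by simp) with h | h
      · exact hM s h
      · simpa [wordLength_inv hT] using hM _ h
    have h2 := ih fun x hx => hl x (List.mem_cons_of_mem _ hx)
    rw [List.prod_cons, map_mul, List.length_cons, mul_add]
    exact (wordLength_mul_le hT _ _).trans (by omega)

theorem exists_wordLength_map_le {H : Type*} [Group H] {T : Set H} (hS : Subgroup.closure S = ⊤)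
    (hSf : S.Finite) (hT : Subgroup.closure T = ⊤) (f : G →* H) :
    ∃ M : ℕ, 1 ≤ M ∧ ∀ g, wordLength T (f g) ≤ M * wordLength S g := by
  obtain ⟨M, hM⟩ := (hSf.image fun s => wordLength T (f s)).bddAbove
  refine ⟨M + 1, by omega, wordLength_map_le hS hT f fun s hs => ?_⟩
  have := hM ⟨s, hs, rfl⟩
  simp only at this
  omega

theorem finite_wordLength_le (hS : Subgroup.closure S = ⊤) (hSf : S.Finite) (n : ℕ) :
    {g : G | wordLength S g ≤ n}.Finite := by
  induction n with
  | zero =>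
    refine (Set.finite_singleton (1 : G)).subset fun g hg => ?_
    exact eq_one_of_wordLength_eq_zero hS (Nat.le_zero.1 hg)
  | succ n ih =>
    refine ((((hSf.union hSf.inv).union (Set.finite_singleton 1)).mul ih)).subset fun g hg => ?_
    obtain ⟨l, hl, rfl, hl'⟩ := exists_word hS g
    rw [Set.mem_ofPred_eq, ← hl'] at hg
    cases l with
    | nil => exact ⟨1, by simp, 1, by simp [wordLength_one], by simp⟩
    | cons s l =>
      refine ⟨s, ?_, l.prod, ?_, by simp⟩
      · rcases hl s (by simp) with h | h
        exacts [Or.inl (Or.inl h), Or.inl (Or.inr h)]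
      · exact (wordLength_prod_le fun x hx => hl x (List.mem_cons_of_mem _ hx)).trans
          (by simpa using hg)

end WordLength

/-! ### The Gromov product at the identity -/

section GromovProduct

variable {G : Type*} [Group G] {S : Set G} {δ : ℝ}

/-- The Gromov product at the identity, in terms of word lengths. -/
noncomputable def gromovProductOne {G : Type*} [Group G] (S : Set G) (x y : G) : ℝ :=
  ((wordLength S x : ℝ) + wordLength S y - wordLength S (x⁻¹ * y)) / 2

theorem gromovProduct_one (x y : G) : gromovProduct S 1 x y = gromovProductOne S x y := by
  simp [gromovProduct, gromovProductOne, wordDist]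

/-- Hyperbolicity of the word metric, tested at the identity. -/
def IsHyperbolicAtOne {G : Type*} [Group G] (S : Set G) (δ : ℝ) : Prop :=
  ∀ x y z : G, min (gromovProductOne S x y) (gromovProductOne S y z) - δ ≤ gromovProductOne S x z

theorem gromovProductOne_comm (hS : Subgroup.closure S = ⊤) (x y : G) :
    gromovProductOne S x y = gromovProductOne S y x := by
  have : wordLength S (x⁻¹ * y) = wordLength S (y⁻¹ * x) := by
    rw [← wordLength_inv hS]; congr 1; group
  simp only [gromovProductOne, this]
  ring

theorem gromovProductOne_nonneg (hS : Subgroup.closure S = ⊤) (x y : G) :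
    0 ≤ gromovProductOne S x y := by
  have h := wordLength_mul_le hS x⁻¹ y
  rw [wordLength_inv hS] at h
  have h' : (wordLength S (x⁻¹ * y) : ℝ) ≤ wordLength S x + wordLength S y := mod_cast h
  unfold gromovProductOne
  linarith

theorem gromovProductOne_one_left (y : G) : gromovProductOne S 1 y = 0 := by
  simp [gromovProductOne, wordLength_one]

/-- An element whose translates of the identity form a local quasi-geodesic. -/
def IsStraight {G : Type*} [Group G] (S : Set G) (δ : ℝ) (n : G) : Prop :=
  2 * gromovProductOne S n⁻¹ n + 4 * δ < wordLength S n

theorem IsStraight.inv (hS : Subgroup.closure S = ⊤) {n : G} (h : IsStraight S δ n) :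
    IsStraight S δ n⁻¹ := by
  rw [IsStraight, inv_inv, wordLength_inv hS, gromovProductOne_comm hS]
  exact h

theorem wordLength_mul_eq (hS : Subgroup.closure S = ⊤) (x y : G) :
    (wordLength S (x * y) : ℝ)
      = wordLength S x + wordLength S y - 2 * gromovProductOne S x⁻¹ y := by
  simp only [gromovProductOne, inv_inv, wordLength_inv hS]
  ring

/-- In the triangle `1`, `x`, `x * y`, the Gromov products at the ends of the side from `1` to `x`
add up to its length; a small product at one end makes the other large. -/
theorem gromovProductOne_self_mul (hS : Subgroup.closure S = ⊤) (x y : G) :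
    gromovProductOne S x (x * y) = wordLength S x - gromovProductOne S x⁻¹ y := by
  simp only [gromovProductOne, inv_inv, wordLength_inv hS, inv_mul_cancel_left]
  ring

/-- Local-to-global principle for the powers of a straight element. -/
theorem IsStraight.gromovProductOne_pow_le (hS : Subgroup.closure S = ⊤) (hδ : 0 ≤ δ)
    (H : IsHyperbolicAtOne S δ) {n : G} (h : IsStraight S δ n) (m : ℕ) :
    gromovProductOne S (n ^ (m + 1))⁻¹ n ≤ gromovProductOne S n⁻¹ n + δ := by
  induction m with
  | zero => simpa using hδ
  | succ m ih =>
    -- By induction and straightness, the product of `n⁻¹` and `(n ^ (m + 2))⁻¹` exceeds the claimed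
    -- bound. If that of `(n ^ (m + 2))⁻¹` and `n` did too, hyperbolicity would make the product of
    -- `n⁻¹` and `n` exceed itself.
    have h1 := H n⁻¹ (n ^ (m + 2))⁻¹ n
    have h2 := gromovProductOne_self_mul hS n⁻¹ (n ^ (m + 1))⁻¹
    have e : n⁻¹ * (n ^ (m + 1))⁻¹ = (n ^ (m + 2))⁻¹ := by
      rw [← mul_inv_rev, ← pow_succ]
    rw [e, inv_inv, gromovProductOne_comm hS n, wordLength_inv hS] at h2
    unfold IsStraight at h
    by_contra! hc
    have : gromovProductOne S n⁻¹ n + δ < min (gromovProductOne S n⁻¹ (n ^ (m + 2))⁻¹)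
        (gromovProductOne S (n ^ (m + 2))⁻¹ n) := lt_min (by linarith) hc
    linarith

/-- Each new factor `n` gains its length minus twice a Gromov product controlled by the
local-to-global bound, and straightness makes this gain at least 1. -/
theorem IsStraight.le_wordLength_pow (hS : Subgroup.closure S = ⊤) (hδ : 1 ≤ δ)
    (H : IsHyperbolicAtOne S δ) {n : G} (h : IsStraight S δ n) (m : ℕ) :
    (m : ℝ) ≤ wordLength S (n ^ m) := by
  induction m with
  | zero => simp
  | succ m ih =>
    have h0 : 2 * gromovProductOne S (n ^ m)⁻¹ n + 1 ≤ wordLength S n := by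
      have h' := h
      unfold IsStraight at h'
      cases m with
      | zero =>
        have h1 := gromovProductOne_nonneg hS n⁻¹ n
        rw [pow_zero, inv_one, gromovProductOne_one_left]
        linarith
      | succ m => linarith [h.gromovProductOne_pow_le hS (by linarith) H m]
    rw [pow_succ, wordLength_mul_eq hS]
    push_cast
    linarith

/-- A power of a straight element moves every point along its axis. -/
theorem IsStraight.exists_pow (hS : Subgroup.closure S = ⊤) (hδ : 1 ≤ δ)
    (H : IsHyperbolicAtOne S δ) {n : G} (h : IsStraight S δ n) :
    ∃ k : ℕ, 0 < k ∧ ∃ C : ℝ, ∀ x : G, ∃ i : ℤ,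
      gromovProductOne S (n ^ i * x) (n ^ k * (n ^ i * x)) ≤ C := by
  -- Large enough that the product of `n ^ k` and `n ^ k * y`, at least `k - |n| / 2 - δ`, exceeds
  -- the final bound `|n| / 2 + 2 * δ`.
  obtain ⟨k, hk⟩ := exists_nat_gt ((wordLength S n : ℝ) + 3 * δ)
  have hk0 : 0 < k := by
    rcases Nat.eq_zero_or_pos k with rfl | h0
    · have : (0 : ℝ) ≤ wordLength S n := Nat.cast_nonneg _
      push_cast at hk; linarith
    · exact h0
  refine ⟨k, hk0, wordLength S n / 2 + 2 * δ, fun x => ?_⟩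
  obtain ⟨i, hi⟩ : ∃ i : ℤ, ∀ j : ℤ, wordLength S (n ^ i * x) ≤ wordLength S (n ^ j * x) := by
    exact ⟨_, fun j => Function.argmin_le (fun i : ℤ => wordLength S (n ^ i * x)) j⟩
  refine ⟨i, ?_⟩
  set y := n ^ i * x with hy
  -- Since `y` is a shortest point of its `⟨n⟩`-orbit, it cannot point far along `n` or `n⁻¹`; as `m
  -- ^ k` starts out along `m`, it cannot point far along `m ^ k` either.
  have near : ∀ m : G, (m = n ∨ m = n⁻¹) → IsStraight S δ m →
      wordLength S m = wordLength S n →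
      gromovProductOne S y (m ^ k) ≤ wordLength S n / 2 + δ := by
    intro m hm hst hlen
    have h1 : wordLength S y ≤ wordLength S (y⁻¹ * m) := by
      rw [← wordLength_inv hS (y⁻¹ * m)]
      rcases hm with rfl | rfl
      · have := hi (-1 + i)
        rw [zpow_add, mul_assoc, ← hy, zpow_neg_one] at this
        simpa using this
      · have := hi (1 + i)
        rw [zpow_add, mul_assoc, ← hy, zpow_one] at this
        simpa using this
    have h1' : (wordLength S y : ℝ) ≤ wordLength S (y⁻¹ * m) := mod_cast h1
    have h2 : gromovProductOne S y m ≤ wordLength S n / 2 := by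
      rw [← hlen]
      simp only [gromovProductOne]
      linarith
    obtain ⟨j, rfl⟩ : ∃ j, k = j + 1 := ⟨k - 1, by omega⟩
    have h3 : gromovProductOne S m⁻¹ (m ^ j) ≤ gromovProductOne S m⁻¹ m + δ := by
      cases j with
      | zero =>
        have := gromovProductOne_nonneg hS m⁻¹ m
        rw [pow_zero, gromovProductOne_comm hS, gromovProductOne_one_left]
        linarith
      | succ j =>
        have := (hst.inv hS).gromovProductOne_pow_le hS (by linarith) H j
        rw [inv_inv, gromovProductOne_comm hS m, inv_pow, inv_inv,
          gromovProductOne_comm hS (m ^ (j + 1))] at this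
        exact this
    have h4 := gromovProductOne_self_mul hS m (m ^ j)
    rw [← pow_succ'] at h4
    have h5 := H y (m ^ (j + 1)) m
    rw [gromovProductOne_comm hS _ m] at h5
    unfold IsStraight at hst
    have hlen' : (wordLength S m : ℝ) = wordLength S n := mod_cast hlen
    by_contra! hc
    have : wordLength S n / 2 + δ < min (gromovProductOne S y (m ^ (j + 1)))
        (gromovProductOne S m (m ^ (j + 1))) := lt_min hc (by linarith)
    linarith
  have h1 := near n (Or.inl rfl) h rfl
  have h2 := near n⁻¹ (Or.inr rfl) (h.inv hS) (wordLength_inv hS n)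
  have h3 := gromovProductOne_self_mul hS (n ^ k) y
  rw [← inv_pow, gromovProductOne_comm hS _ y] at h3
  have h4 := H y (n ^ k * y) (n ^ k)
  rw [gromovProductOne_comm hS _ (n ^ k)] at h4
  have h5 := h.le_wordLength_pow hS hδ H k
  by_contra! hc
  have : wordLength S n / 2 + 2 * δ < min (gromovProductOne S y (n ^ k * y))
      (gromovProductOne S (n ^ k) (n ^ k * y)) := lt_min hc (by linarith)
  linarith

/-- Gromov products along a path of length at most `2 ^ j`. -/
theorem IsHyperbolicAtOne.path (H : IsHyperbolicAtOne S δ) {p : ℕ → G} {B : ℝ}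
    (j : ℕ) : ∀ a m, m ≤ 2 ^ j → (∀ i, a ≤ i → i ≤ a + m → B ≤ wordLength S (p i)) →
      (∀ i, a ≤ i → i < a + m → B ≤ gromovProductOne S (p i) (p (i + 1))) →
      B - j * δ ≤ gromovProductOne S (p a) (p (a + m)) := by
  have self : ∀ x, gromovProductOne S x x = wordLength S x := fun x => by
    simp [gromovProductOne, wordLength_one]
  induction j with
  | zero =>
    intro a m hm h1 h2
    rcases Nat.le_one_iff_eq_zero_or_eq_one.1 hm with rfl | rfl
    · simpa [self] using h1 a le_rfl (by omega)
    · simpa using h2 a le_rfl (by omega)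
  | succ j ih =>
    intro a m hm h1 h2
    rw [pow_succ] at hm
    -- Bisecting the path costs one `δ` per level, so the total loss is logarithmic in its length.
    have h3 := ih a (m / 2) (by omega) (fun i hi hi' => h1 i hi (by omega))
      (fun i hi hi' => h2 i hi (by omega))
    have h4 := ih (a + m / 2) (m - m / 2) (by omega) (fun i hi hi' => h1 i (by omega) (by omega))
      (fun i hi hi' => h2 i (by omega) (by omega))
    rw [show a + m / 2 + (m - m / 2) = a + m by omega] at h4
    have h5 := H (p a) (p (a + m / 2)) (p (a + m))
    have := le_min h3 h4
    push_cast
    linarith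

end GromovProduct

/-! ### Straight elements in infinite normal subgroups -/

section Straight

variable {G : Type*} [Group G] {S : Set G} {δ : ℝ}

/-- The product of two long elements pointing in different directions is straight. -/
theorem IsStraight.mul_of_le (hS : Subgroup.closure S = ⊤)
    (H : IsHyperbolicAtOne S δ) {f g : G} {A ℓ : ℝ} (hf : ℓ ≤ wordLength S f)
    (hg : ℓ ≤ wordLength S g) (h1 : gromovProductOne S f⁻¹ g ≤ A)
    (h2 : gromovProductOne S f g⁻¹ ≤ A) (hℓ : 2 * A + 4 * δ < ℓ) (hδ : 0 ≤ δ) :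
    IsStraight S δ (f * g) := by
  have hA := (gromovProductOne_nonneg hS f⁻¹ g).trans h1
  have h3 := gromovProductOne_self_mul hS f g
  have h4 := gromovProductOne_self_mul hS g⁻¹ f⁻¹
  rw [← mul_inv_rev, inv_inv, wordLength_inv hS, gromovProductOne_comm hS g,
    gromovProductOne_comm hS g⁻¹] at h4
  -- `f * g` points along `f` and its inverse along `g⁻¹`; as `f` and `g⁻¹` diverge, so do `f * g`
  -- and its inverse, at the cost of two `δ`.
  have h5 := H f (f * g) g⁻¹
  have h6 := H (f * g) (f * g)⁻¹ g⁻¹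
  have h7 := wordLength_mul_eq hS f g
  rw [gromovProductOne_comm hS (f * g) (f * g)⁻¹] at h6
  have h8 : gromovProductOne S (f * g)⁻¹ (f * g) ≤ A + 2 * δ := by
    by_contra! hc
    have h9 : A + 2 * δ < min (gromovProductOne S (f * g)⁻¹ (f * g))
      (gromovProductOne S (f * g)⁻¹ g⁻¹) := lt_min hc (by linarith)
    have h10 : A + δ < min (gromovProductOne S f (f * g))
      (gromovProductOne S (f * g) g⁻¹) := lt_min (by linarith) (by linarith)
    linarith
  unfold IsStraight
  linarith

/-- If `f` and `f⁻¹` point in the direction of `m`, then `f` displaces `m` less than the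
identity. -/
theorem wordLength_conj_le (hS : Subgroup.closure S = ⊤) (H : IsHyperbolicAtOne S δ) {f m : G}
    (h1 : wordLength S m - δ ≤ gromovProductOne S m f)
    (h2 : wordLength S m - δ ≤ gromovProductOne S m f⁻¹)
    (hf : 2 * wordLength S m ≤ wordLength S f) (hδ : 0 ≤ δ) :
    (wordLength S (m⁻¹ * f * m) : ℝ) ≤ wordLength S f - 2 * wordLength S m + 6 * δ := by
  have h3 := H (f⁻¹ * m) f⁻¹ m
  have h4 : gromovProductOne S (f⁻¹ * m) f⁻¹
      = (wordLength S (m⁻¹ * f) + wordLength S f - wordLength S m) / 2 := by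
    simp only [gromovProductOne]
    rw [show (f⁻¹ * m)⁻¹ * f⁻¹ = m⁻¹ by group, wordLength_inv hS, wordLength_inv hS,
      ← wordLength_inv hS (f⁻¹ * m), show (f⁻¹ * m)⁻¹ = m⁻¹ * f by group]
  have h5 : gromovProductOne S (f⁻¹ * m) m
      = (wordLength S (m⁻¹ * f) + wordLength S m - wordLength S (m⁻¹ * f * m)) / 2 := by
    simp only [gromovProductOne]
    rw [show (f⁻¹ * m)⁻¹ * m = m⁻¹ * f * m by group,
      ← wordLength_inv hS (f⁻¹ * m), show (f⁻¹ * m)⁻¹ = m⁻¹ * f by group]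
  have h6 : (wordLength S (m⁻¹ * f) : ℝ)
      = wordLength S m + wordLength S f - 2 * gromovProductOne S m f := by
    rw [wordLength_mul_eq hS, wordLength_inv hS, inv_inv]
  have h7 : wordLength S f ≤ wordLength S m + wordLength S (m⁻¹ * f) := by
    simpa using wordLength_mul_le hS m (m⁻¹ * f)
  have h7' : (wordLength S f : ℝ) ≤ wordLength S m + wordLength S (m⁻¹ * f) := mod_cast h7
  have hf' : (2 * wordLength S m : ℝ) ≤ wordLength S f := mod_cast hf
  rw [gromovProductOne_comm hS f⁻¹] at h3
  have h8 : (wordLength S m : ℝ) - δ ≤ min (gromovProductOne S (f⁻¹ * m) f⁻¹)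
      (gromovProductOne S m f⁻¹) := le_min (by rw [h4]; linarith) h2
  linarith

/-- A finite set of elements of a normal subgroup without straight elements has a point of bounded
displacement. -/
theorem exists_conj_wordLength_le (hS : Subgroup.closure S = ⊤) (hδ : 1 ≤ δ)
    (H : IsHyperbolicAtOne S δ) (N : Subgroup G) [N.Normal]
    (hN : ∀ n ∈ N, ¬ IsStraight S δ n) (F : Finset G) (hF : ∀ f ∈ F, f ∈ N) :
    ∃ x : G, ∀ f ∈ F, (wordLength S (x⁻¹ * f * x) : ℝ) ≤ 100 * δ := by
  -- Take a point minimising the largest displacement over `F`. If that were large, moving a little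
  -- towards the image of the point under the worst element would reduce it.
  obtain ⟨x, hx⟩ : ∃ x : G, ∀ y : G, (F.sup fun f => wordLength S (x⁻¹ * f * x))
      ≤ F.sup fun f => wordLength S (y⁻¹ * f * y) :=
    ⟨_, fun j => Function.argmin_le (fun y : G => F.sup fun f => wordLength S (y⁻¹ * f * y)) j⟩
  refine ⟨x, fun f₁ hf₁ => ?_⟩
  by_contra! hlt
  obtain ⟨f', hf', hmax⟩ := F.exists_mem_eq_sup ⟨f₁, hf₁⟩ fun f => wordLength S (x⁻¹ * f * x)
  have hconj : ∀ f ∈ F, x⁻¹ * f * x ∈ N := fun f hf => by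
    simpa using ‹N.Normal›.conj_mem f (hF f hf) x⁻¹
  have hle : ∀ f ∈ F, wordLength S (x⁻¹ * f * x) ≤ wordLength S (x⁻¹ * f' * x) := fun f hf =>
    hmax ▸ Finset.le_sup (f := fun f => wordLength S (x⁻¹ * f * x)) hf
  set f₀ := x⁻¹ * f' * x with hf₀
  have hL : 100 * δ < wordLength S f₀ := hlt.trans_le (mod_cast hle f₁ hf₁)
  -- `4 * δ ≤ t` makes the gain `2 * t` beat the error `6 * δ` of `wordLength_conj_le`; `t ≤ 5 * δ`
  -- keeps `t` small against `100 * δ`.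
  obtain ⟨t, ht, ht'⟩ : ∃ t : ℕ, 4 * δ ≤ t ∧ (t : ℝ) ≤ 5 * δ :=
    ⟨⌈4 * δ⌉₊, Nat.le_ceil _, (Nat.ceil_lt_add_one (by linarith)).le.trans (by linarith)⟩
  obtain ⟨m, hm, hm'⟩ := exists_mul_wordLength hS f₀ (t := t) (by
    have : (t : ℝ) ≤ wordLength S f₀ := by linarith
    exact_mod_cast this)
  have hm1 : (wordLength S m : ℝ) = t := mod_cast hm
  have hm2 : (wordLength S (m⁻¹ * f₀) : ℝ) + t = wordLength S f₀ := mod_cast hm'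
  have hmf : gromovProductOne S m f₀ = t := by
    simp only [gromovProductOne]
    linarith
  -- Without straight elements, every long `f` in `N` points in nearly the same direction as `f⁻¹`.
  have hb : ∀ f ∈ N, (wordLength S f : ℝ) ≤ 2 * gromovProductOne S f⁻¹ f + 4 * δ :=
    fun f hf => not_lt.1 (hN f hf)
  -- the displacement of `x * m` is smaller, a contradiction
  have hlt' : ∀ f ∈ F, wordLength S ((x * m)⁻¹ * f * (x * m)) < wordLength S f₀ := by
    intro f hf
    have hfN := hconj f hf
    have hfle : (wordLength S (x⁻¹ * f * x) : ℝ) ≤ wordLength S f₀ := mod_cast hle f hf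
    rw [show (x * m)⁻¹ * f * (x * m) = m⁻¹ * (x⁻¹ * f * x) * m by group]
    generalize x⁻¹ * f * x = e at hfN hfle
    rw [← Nat.cast_lt (α := ℝ)]
    rcases lt_or_ge (wordLength S e + 2 * t : ℝ) (wordLength S f₀) with hs | hs
    · have h1 := wordLength_mul_le hS (m⁻¹ * e) m
      have h2 := wordLength_mul_le hS m⁻¹ e
      rw [wordLength_inv hS] at h2
      have h3 : (wordLength S (m⁻¹ * e * m) : ℝ) ≤ wordLength S m + wordLength S e + wordLength S m :=
        mod_cast h1.trans (by omega)
      linarith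
    have he := hb e hfN
    have he0 := hb f₀ (hconj f' hf')
    have key : t + 2 * δ ≤ gromovProductOne S e f₀ ∧ t + 2 * δ ≤ gromovProductOne S e⁻¹ f₀ := by
      by_contra hc
      -- in this case `e * f₀` is straight
      have hor : gromovProductOne S e f₀ < t + 2 * δ ∨ gromovProductOne S e⁻¹ f₀ < t + 2 * δ := by
        by_contra! h
        exact hc h
      have h1 : gromovProductOne S e f₀ ≤ t + 3 * δ ∧ gromovProductOne S e⁻¹ f₀ ≤ t + 3 * δ := by
        rcases hor with h | h
        · refine ⟨by linarith, ?_⟩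
          by_contra! h'
          have h2 := H e e⁻¹ f₀
          have h3 : t + 3 * δ < min (gromovProductOne S e e⁻¹) (gromovProductOne S e⁻¹ f₀) :=
            lt_min (by rw [gromovProductOne_comm hS]; linarith) h'
          linarith
        · refine ⟨?_, by linarith⟩
          by_contra! h'
          have h2 := H e⁻¹ e f₀
          have h3 : t + 3 * δ < min (gromovProductOne S e⁻¹ e) (gromovProductOne S e f₀) :=
            lt_min (by linarith) h'
          linarith
      have h2 : gromovProductOne S e f₀⁻¹ ≤ t + 4 * δ := by
        by_contra! h'
        have h3 := H e f₀⁻¹ f₀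
        have h4 : t + 4 * δ < min (gromovProductOne S e f₀⁻¹) (gromovProductOne S f₀⁻¹ f₀) :=
          lt_min h' (by linarith)
        linarith
      refine hN _ (N.mul_mem hfN (hconj f' hf')) (IsStraight.mul_of_le hS H
        (A := t + 4 * δ) (ℓ := wordLength S f₀ - 2 * t) ?_ ?_ ?_ ?_ ?_ ?_) <;> linarith
    have h1 := H m f₀ e
    have h2 := H m f₀ e⁻¹
    rw [gromovProductOne_comm hS f₀] at h1 h2
    have h3 : (t : ℝ) ≤ min (gromovProductOne S m f₀) (gromovProductOne S e f₀) :=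
      le_min hmf.ge (by linarith [key.1])
    have h4 : (t : ℝ) ≤ min (gromovProductOne S m f₀) (gromovProductOne S e⁻¹ f₀) :=
      le_min hmf.ge (by linarith [key.2])
    have h5 := wordLength_conj_le hS H (f := e) (m := m) (by linarith) (by linarith)
      (by
        have : (2 * wordLength S m : ℝ) ≤ wordLength S e := by linarith
        exact_mod_cast this) (by linarith)
    linarith
  have h0 := hx (x * m)
  rw [hmax] at h0
  refine absurd h0 (not_le.2 ((Finset.sup_lt_iff ?_).2 hlt'))
  have : (0 : ℝ) < wordLength S f₀ := by linarith
  exact_mod_cast this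

/-- An infinite normal subgroup of a hyperbolic group contains a straight element. -/
theorem exists_isStraight (hS : Subgroup.closure S = ⊤) (hSf : S.Finite) (hδ : 1 ≤ δ)
    (H : IsHyperbolicAtOne S δ) (N : Subgroup G) [N.Normal] [Infinite N] :
    ∃ n ∈ N, IsStraight S δ n := by
  by_contra! hN
  have hB := finite_wordLength_le hS hSf ⌊100 * δ⌋₊
  obtain ⟨F, hF, hcard⟩ := (Set.infinite_coe_iff.1 ‹Infinite N›).exists_subset_card_eq
    (hB.toFinset.card + 1)
  obtain ⟨x, hx⟩ := exists_conj_wordLength_le hS hδ H N hN F fun f hf => hF hf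
  -- Pigeonhole: conjugation by `x⁻¹` injects `F` into a ball with fewer elements.
  have := Finset.card_le_card_of_injOn (s := F) (t := hB.toFinset) (fun f => x⁻¹ * f * x)
    (fun f hf => by simpa using Nat.le_floor (hx f hf)) (fun a _ b _ h => by simpa using h)
  omega

end Straight

/-! ### Conjugacy norms -/

section ConjNorm

variable {N : Type*} [Group N] {T : Set N}

theorem conjNorm_mk_le (x : N) : conjNorm T (ConjClasses.mk x) ≤ wordLength T x :=
  Nat.sInf_le ⟨x, rfl, rfl⟩

theorem exists_conjNorm_eq (T : Set N) (c : ConjClasses N) :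
    ∃ x, ConjClasses.mk x = c ∧ wordLength T x = conjNorm T c := by
  obtain ⟨x, hx⟩ := ConjClasses.exists_rep c
  exact Nat.sInf_mem (s := wordLength T '' {g | ConjClasses.mk g = c}) ⟨_, x, hx, rfl⟩

theorem conjNorm_pos (hT : Subgroup.closure T = ⊤) {c : ConjClasses N} (hc : c ≠ 1) :
    0 < conjNorm T c := by
  obtain ⟨x, rfl, hx⟩ := exists_conjNorm_eq T c
  refine Nat.pos_of_ne_zero fun h => hc ?_
  rw [eq_one_of_wordLength_eq_zero hT (hx.trans h)]
  rfl

theorem exists_conjNorm_outerConjClasses_le (hT : Subgroup.closure T = ⊤) (hTf : T.Finite)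
    (Φ : OuterAut N) :
    ∃ M : ℕ, 1 ≤ M ∧ ∀ c, conjNorm T (outerConjClasses N Φ c) ≤ M * conjNorm T c := by
  obtain ⟨φ, rfl⟩ := QuotientGroup.mk_surjective Φ
  obtain ⟨M, hM, h⟩ := exists_wordLength_map_le hT hTf hT φ.toMonoidHom
  refine ⟨M, hM, fun c => ?_⟩
  obtain ⟨x, rfl, hx⟩ := exists_conjNorm_eq T c
  rw [outerConjClasses_mk, ← hx]
  exact (conjNorm_mk_le _).trans (h x)

/-- A homomorphism to `Out(N)` is exponentially bounded in terms of word length. -/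
theorem exists_conjNorm_le_pow {Q : Type*} [Group Q] {S : Set Q} (hS : Subgroup.closure S = ⊤)
    (hSf : S.Finite) (hT : Subgroup.closure T = ⊤) (hTf : T.Finite) (χ : Q →* OuterAut N) :
    ∃ M : ℕ, 1 ≤ M ∧ ∀ r c,
      conjNorm T (outerConjClasses N (χ r) c) ≤ M ^ wordLength S r * conjNorm T c := by
  choose f hf1 hf using fun r => exists_conjNorm_outerConjClasses_le hT hTf (χ r)
  obtain ⟨M, hM⟩ := ((hSf.union hSf.inv).image f).bddAbove
  -- The extra 1 keeps the factor at least 1 even when `S` is empty.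
  refine ⟨M + 1, by omega, fun r c => ?_⟩
  obtain ⟨l, hl, rfl, hl'⟩ := exists_word hS r
  rw [← hl']
  clear hl'
  induction l with
  | nil => simp
  | cons s l ih =>
    have h1 : f s ≤ M := hM ⟨s, (hl s (by simp)).imp id fun h => h, rfl⟩
    have h2 := ih fun x hx => hl x (List.mem_cons_of_mem _ hx)
    rw [List.prod_cons, map_mul, map_mul, Equiv.Perm.mul_apply, List.length_cons, pow_succ',
      mul_assoc]
    exact (hf s _).trans (Nat.mul_le_mul (by omega) h2)

end ConjNorm

/-! ### Exponential growth -/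

section Growth

variable {N G Q : Type*} [Group N] [Group G] [Group Q]

/-- Enlarging `δ` is harmless; `1 ≤ δ` lets it absorb integer rounding and serve as a divisor. -/
theorem IsHyperbolicGroup.exists_isHyperbolicAtOne (hG : IsHyperbolicGroup G) :
    ∃ S : Set G, S.Finite ∧ Subgroup.closure S = ⊤ ∧ ∃ δ : ℝ, 1 ≤ δ ∧ IsHyperbolicAtOne S δ := by
  obtain ⟨S, hSf, hS, δ, h⟩ := hG
  refine ⟨S, hSf, hS, max δ 1, le_max_right _ _, fun x y z => ?_⟩
  have := h 1 x y z
  simp only [gromovProduct_one] at this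
  linarith [le_max_left δ 1]

/-- Paths in a coset of the kernel that is far from the identity have exponential length. -/
theorem sub_log_mul_le_gromovProductOne (E : GroupExtension N G Q) {T : Set N}
    (hT : Subgroup.closure T = ⊤) {A : Set G} {δ : ℝ}
    (H : IsHyperbolicAtOne A δ) {S : Set Q} {M M' : ℕ}
    (hM : ∀ x, wordLength A (E.inl x) ≤ M * wordLength T x) (hM1 : 1 ≤ M')
    (hM' : ∀ g, wordLength S (E.rightHom g) ≤ M' * wordLength A g) (y : G) (w : N) :
    (wordLength S (E.rightHom y) : ℝ) / M' - M / 2 - (Nat.log 2 (wordLength T w) + 1) * δ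
      ≤ gromovProductOne A y (y * E.inl w) := by
  obtain ⟨l, hl, hw, hl'⟩ := exists_word hT w
  -- Multiplying by prefixes in `N` does not change the image in `Q`, so the whole path stays far
  -- from `1`. Its steps have length at most `M`, whence the loss `M / 2`.
  have hfar : ∀ i, (wordLength S (E.rightHom y) : ℝ) / M'
      ≤ wordLength A (y * E.inl (l.take i).prod) := by
    intro i
    have h1 := hM' (y * E.inl (l.take i).prod)
    rw [map_mul, E.rightHom_inl, mul_one, mul_comm] at h1
    rw [div_le_iff₀ (by exact_mod_cast hM1)]
    exact_mod_cast h1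
  have h := H.path (p := fun i => y * E.inl (l.take i).prod)
    (B := (wordLength S (E.rightHom y) : ℝ) / M' - M / 2) (Nat.log 2 (wordLength T w) + 1)
    0 (wordLength T w) (Nat.lt_pow_succ_log_self (by norm_num) _).le
    (fun i _ _ => by
      have := hfar i
      have : (0 : ℝ) ≤ M := Nat.cast_nonneg _
      linarith)
    (fun i _ hi => by
      have h1 := hfar i
      have h2 := hfar (i + 1)
      have hi' : i < l.length := by omega
      have h3 : (y * E.inl (l.take i).prod)⁻¹ * (y * E.inl (l.take (i + 1)).prod)
          = E.inl l[i] := by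
        rw [List.prod_take_succ l i hi', map_mul]
        group
      have h4 : wordLength A (E.inl l[i]) ≤ M :=
        (hM _).trans ((Nat.mul_le_mul_left M (wordLength_of_mem (hl _ (List.getElem_mem hi')))).trans
          (mul_one M).le)
      have h4' : (wordLength A (E.inl l[i]) : ℝ) ≤ M := mod_cast h4
      simp only [gromovProductOne, h3]
      linarith)
  have h5 : l.take (wordLength T w) = l := by rw [← hl', List.take_length]
  simp only [zero_add, h5, hw, List.take_zero, List.prod_nil, map_one, mul_one] at h
  push_cast at h
  exact h

/-- Some non-trivial conjugacy class of the kernel grows exponentially under the outer action. -/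
theorem exists_le_log_conjNorm (E : GroupExtension N G Q) (hG : IsHyperbolicGroup G)
    [Infinite N] {T : Set N} (hTf : T.Finite) (hT : Subgroup.closure T = ⊤)
    {S : Set Q} (hS : Subgroup.closure S = ⊤) :
    ∃ v : N, v ≠ 1 ∧ ∃ κ ℓ : ℝ, 1 ≤ κ ∧ 0 ≤ ℓ ∧ ∀ g : G,
      κ⁻¹ * wordLength S (E.rightHom g) - ℓ
        ≤ Real.log (conjNorm T (ConjClasses.mk (E.conjAct g v))) := by
  obtain ⟨A, hAf, hA, δ, hδ, H⟩ := hG.exists_isHyperbolicAtOne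
  obtain ⟨M, -, hM⟩ := exists_wordLength_map_le hT hTf hA E.inl
  obtain ⟨M', hM1, hM'⟩ := exists_wordLength_map_le hA hAf hS E.rightHom
  have : E.inl.range.Normal := by rw [E.range_inl_eq_ker_rightHom]; infer_instance
  have : Infinite E.inl.range :=
    Infinite.of_injective _ (E.inl.rangeRestrict_injective_iff.2 E.inl_injective)
  obtain ⟨_, ⟨n, rfl⟩, hn⟩ := exists_isStraight hA hAf hδ H E.inl.range
  obtain ⟨k, hk, C, hC⟩ := hn.exists_pow hA hδ H
  have hv : n ^ k ≠ 1 := by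
    intro h
    have h1 := hn.le_wordLength_pow hA hδ H k
    rw [← map_pow, h, map_one, wordLength_one] at h1
    have : k ≤ 0 := by exact_mod_cast h1
    omega
  have hlog : 0 < Real.log 2 := Real.log_pos one_lt_two
  have hM1' : (1 : ℝ) ≤ M' := mod_cast hM1
  -- The constants come from solving `|q| / M' - M / 2 - (log₂ |w| + 1) * δ ≤ C` for `log |w|`, with
  -- `q` the image of `g`.
  refine ⟨n ^ k, hv, M' * δ / Real.log 2, max 0 (Real.log 2 * ((M / 2 + C) / δ + 1)), ?_,
    le_max_left _ _, fun g => ?_⟩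
  · rw [le_div_iff₀ hlog]
    have : Real.log 2 < 1 := Real.log_two_lt_d9.trans (by norm_num)
    nlinarith
  obtain ⟨w, hw, hwl⟩ := exists_conjNorm_eq T (ConjClasses.mk (E.conjAct g (n ^ k)))
  have hw0 : wordLength T w ≠ 0 := by
    rw [hwl]
    refine (conjNorm_pos hT fun h => hv ?_).ne'
    rw [ConjClasses.one_eq_mk_one, ConjClasses.mk_eq_mk_iff_isConj, isConj_one_left] at h
    exact (map_eq_one_iff _ (MulEquiv.injective _)).1 h
  rw [ConjClasses.mk_eq_mk_iff_isConj] at hw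
  obtain ⟨h, rfl⟩ := isConj_iff.1 hw.symm
  set w := h * E.conjAct g (n ^ k) * h⁻¹ with hwdef
  obtain ⟨i, hi⟩ := hC (E.inl h * g)⁻¹
  set y := E.inl n ^ i * (E.inl h * g)⁻¹ with hy
  have h1 : y * E.inl w = E.inl n ^ k * y := by
    rw [hwdef, map_mul, map_mul, E.inl_conjAct_comm, map_inv, map_pow, hy]
    have : E.inl n ^ i * E.inl n ^ k = E.inl n ^ k * E.inl n ^ i := by
      rw [← zpow_natCast, ← zpow_add, ← zpow_add, add_comm]
    simp only [mul_inv_rev, mul_assoc, inv_mul_cancel_left]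
    rw [← mul_assoc, this, mul_assoc]
  have h2 : wordLength S (E.rightHom y) = wordLength S (E.rightHom g) := by
    rw [hy, ← map_zpow, map_mul, map_inv, map_mul, E.rightHom_inl, E.rightHom_inl, one_mul,
      one_mul, wordLength_inv hS]
  have h3 := sub_log_mul_le_gromovProductOne E hT H hM hM1 hM' y w
  rw [h1, h2] at h3
  have h4 := h3.trans hi
  have h5 : Nat.log 2 (wordLength T w) * Real.log 2 ≤ Real.log (wordLength T w) := by
    rw [← Real.log_pow]
    refine Real.log_le_log (by positivity) ?_
    exact_mod_cast Nat.pow_log_le_self 2 hw0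
  rw [← hwl]
  refine le_trans ?_ h5
  refine (sub_le_sub_left (le_max_right _ _) _).trans ?_
  have h6 : (M' * δ / Real.log 2)⁻¹ * (wordLength S (E.rightHom g) : ℝ)
      - Real.log 2 * ((M / 2 + C) / δ + 1)
      = ((wordLength S (E.rightHom g) : ℝ) / M' - M / 2 - C - δ) / δ * Real.log 2 := by
    have : δ ≠ 0 := by positivity
    have : (M' : ℝ) ≠ 0 := by positivity
    field_simp
    ring
  rw [h6]
  refine mul_le_mul_of_nonneg_right ?_ hlog.le
  rw [div_le_iff₀ (by linarith)]
  linarith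

end Growth

theorem ENNReal.log_natCast_eq {n : ℕ} (hn : 0 < n) :
    ENNReal.log (n : ENNReal) = ((Real.log n : ℝ) : EReal) := by
  rw [← ENNReal.ofReal_natCast, ENNReal.log_ofReal_of_pos (by exact_mod_cast hn)]

theorem mainTheorem4 {N G Q : Type*} [Group N] [Group G] [Group Q]
    (E : GroupExtension N G Q)
    (hG : IsHyperbolicGroup G) (hG' : ¬ IsElementaryGroup G)
    (hN : Infinite N)
    (T : Set N) (hT : T.Finite) (hT' : Subgroup.closure T = ⊤)
    (S : Set Q) (hS : S.Finite) (hS' : Subgroup.closure S = ⊤) :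
    ∃ κ ℓ : ℝ, 1 ≤ κ ∧ 0 ≤ ℓ ∧ ∀ q q' : Q,
      ((κ⁻¹ * (wordDist S q' q : ℝ) - ℓ : ℝ) : EReal)
          ≤ lipDist T (outerAction E q') (outerAction E q) ∧
        lipDist T (outerAction E q') (outerAction E q)
          ≤ ((κ * (wordDist S q' q : ℝ) : ℝ) : EReal) := by
  obtain ⟨Λ, hΛ1, hΛ⟩ := exists_conjNorm_le_pow hS' hS hT' hT (outerAction E)
  obtain ⟨v, hv, κ, ℓ, hκ, hℓ, hlow⟩ := exists_le_log_conjNorm E hG hT hT' hS'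
  have hv' : ConjClasses.mk v ≠ 1 := fun h => hv <| by
    rwa [ConjClasses.one_eq_mk_one, ConjClasses.mk_eq_mk_iff_isConj, isConj_one_left] at h
  have hpos := conjNorm_pos hT' hv'
  have hlogv : 0 ≤ Real.log (conjNorm T (ConjClasses.mk v)) := Real.log_natCast_nonneg _
  have hlen : ∀ q q' : Q, wordLength S (q⁻¹ * q') = wordDist S q' q := fun q q' => by
    rw [wordDist, ← wordLength_inv hS', mul_inv_rev, inv_inv]
  refine ⟨max κ (Real.log Λ), ℓ + Real.log (conjNorm T (ConjClasses.mk v)),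
    hκ.trans (le_max_left _ _), by positivity, fun q q' => ⟨?_, ?_⟩⟩
  -- Test the supremum on the class of `v` moved by `χ(q')`: the denominator is then the fixed norm
  -- of `v`, absorbed into the additive constant, and the numerator is the norm of `v` moved by a
  -- lift of `q⁻¹ * q'`.
  · obtain ⟨g, hg⟩ := E.rightHom_surjective (q⁻¹ * q')
    have h1 := hlow g
    rw [hg, hlen] at h1
    have e1 : outerConjClasses N (outerAction E q')⁻¹
        (outerConjClasses N (outerAction E q') (ConjClasses.mk v)) = ConjClasses.mk v := by
      rw [← Equiv.Perm.mul_apply, ← map_mul, inv_mul_cancel, map_one, Equiv.Perm.one_apply]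
    have e2 : outerConjClasses N (outerAction E q)⁻¹
        (outerConjClasses N (outerAction E q') (ConjClasses.mk v))
          = ConjClasses.mk (E.conjAct g v) := by
      rw [← Equiv.Perm.mul_apply, ← map_mul, ← map_inv, ← map_mul, ← hg, outerAction_rightHom,
        outerConjClasses_mk]
    have hone : ∀ Φ : OuterAut N, outerConjClasses N Φ 1 = 1 := fun Φ => by
      obtain ⟨φ, rfl⟩ := QuotientGroup.mk_surjective Φ
      rw [ConjClasses.one_eq_mk_one, outerConjClasses_mk, map_one]
    have hc : outerConjClasses N (outerAction E q') (ConjClasses.mk v) ≠ 1 := fun h => hv' <| by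
      rw [← e1, h, hone]
    have hc2 : ConjClasses.mk (E.conjAct g v) ≠ 1 := fun h => hv <| by
      rw [ConjClasses.one_eq_mk_one, ConjClasses.mk_eq_mk_iff_isConj, isConj_one_left] at h
      simpa using h
    have hpos2 := conjNorm_pos hT' hc2
    refine le_trans ?_ (ENNReal.log_monotone (le_iSup _ ⟨_, hc⟩))
    simp only [e1, e2]
    rw [← ENNReal.ofReal_natCast, ← ENNReal.ofReal_natCast,
      ← ENNReal.ofReal_div_of_pos (by exact_mod_cast hpos),
      ENNReal.log_ofReal_of_pos (by positivity), EReal.coe_le_coe_iff,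
      Real.log_div (by positivity) (by positivity)]
    have h2 : (max κ (Real.log Λ))⁻¹ * (wordDist S q' q : ℝ) ≤ κ⁻¹ * wordDist S q' q := by
      have := le_max_left κ (Real.log Λ)
      gcongr
    linarith
  · have h1 : lipDist T (outerAction E q') (outerAction E q)
        ≤ ENNReal.log ((Λ ^ wordDist S q' q : ℕ) : ENNReal) := by
      refine ENNReal.log_monotone (iSup_le fun c => ENNReal.div_le_of_le_mul ?_)
      -- `χ(q)⁻¹ c` is obtained from `χ(q')⁻¹ c` by the action of `q⁻¹ * q'`, so one exponential
      -- bound serves all classes.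
      have h2 := hΛ (q⁻¹ * q') (outerConjClasses N (outerAction E q')⁻¹ c.1)
      rw [← Equiv.Perm.mul_apply, ← map_mul, map_mul (outerAction E), mul_assoc, mul_inv_cancel,
        mul_one, map_inv, hlen] at h2
      exact_mod_cast h2
    refine h1.trans ?_
    rw [ENNReal.log_natCast_eq (by positivity), EReal.coe_le_coe_iff, Nat.cast_pow, Real.log_pow,
      mul_comm]
    gcongr
    exact le_max_right _ _
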